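/- **Theorem.** Let $(\Omega,\mathcal F,P)$ be a probability space. A function $\theta:\mathbb R^d\to[0,\infty]$ is called a *Young function* if it is convex and lower semicontinuous, $\theta(0)=0$, $\theta(x)=\theta(|x|)$ for all $x$ (where $|x|=(|x_1|,\dots,|x_d|)$), its domain $\{\theta<\infty\}$ contains a neighbourhood of $0$, and there are $a>0$ and $b\in\mathbb R$ with $\theta(x)\ge a\|x\|-b$ for all $x$ (Euclidean norm). Its convex conjugate $\theta^*(y)=\sup_{x\in\mathbb R^d}\{x\cdot y-\theta(x)\}$ is then again a Young function. For a random vector $X\in L^0(\mathbb R^d)$ (random vectors that are a.s. equal being identified) let $$\|X\|_\theta=\inf\{\lambda>0:\ E[\theta(X/\lambda)]\le 1\}\qquad(\inf\emptyset=\infty),$$ $$L^\theta=\{X\in L^0(\mathbb R^d):\ \|X\|_\theta<\infty\},\qquad M^\theta=\{X\in L^0(\mathbb R^d):\ E[\theta(X/\lambda)]<\infty\ \text{for all }\lambda>0\},$$ both normed by $\|\cdot\|_\theta$; define $L^{\theta^*}$ in the same way from $\theta^*$. If $\theta$ is a Young function that is finite, i.e. $\theta(x)<\infty$ for all $x\in\mathbb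 R^d$, then the topological dual of $(M^\theta,\|\cdot\|_\theta)$ is $(L^{\theta^*},\|\cdot\|_{\theta^*})$ under the pairing $E[X\cdot Y]$. That is, $X\cdot Y$ is integrable for all $X\in M^\theta$ and $Y\in L^{\theta^*}$, and the map $$L^{\theta^*}\to (M^\theta)',\qquad Y\longmapsto\bigl(X\mapsto E[X\cdot Y]\bigr),$$ is well defined and is a linear homeomorphism of $L^{\theta^*}$ onto the dual $(M^\theta)'$ with its operator norm. -/

import Mathlib

open MeasureTheory Topology
open scoped ENNReal NNReal

/-- The componentwise absolute value (the lattice modulus) of a vector of `ℝᵈ`. -/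
noncomputable def vecAbs {d : ℕ} (x : EuclideanSpace ℝ (Fin d)) : EuclideanSpace ℝ (Fin d) :=
  WithLp.toLp 2 (fun k => |x k|)

/-- A `d`-variate Young function `θ : ℝᵈ → [0, ∞]`. Convexity of a `[0, ∞]`-valued function is
stated with weights in `ℝ≥0`, since `ℝ` does not act on `[0, ∞]`. -/
structure YoungFunction (d : ℕ) where
  toFun : EuclideanSpace ℝ (Fin d) → ℝ≥0∞
  convex' : ConvexOn ℝ≥0 Set.univ toFun
  lsc' : LowerSemicontinuous toFun
  map_abs' : ∀ x, toFun (vecAbs x) = toFun x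
  map_zero' : toFun 0 = 0
  dom_mem_nhds' : {x | toFun x < ∞} ∈ 𝓝 0
  growth' : ∃ a b : ℝ, 0 < a ∧ ∀ x, ENNReal.ofReal (a * ‖x‖ - b) ≤ toFun x

namespace YoungFunction

variable {d : ℕ}

instance : CoeFun (YoungFunction d) (fun _ => EuclideanSpace ℝ (Fin d) → ℝ≥0∞) := ⟨toFun⟩

/-- `θ` is finite if its effective domain is all of `ℝᵈ`. -/
def IsFinite (θ : YoungFunction d) : Prop := ∀ x, θ x < ∞

theorem map_neg (θ : YoungFunction d) (x : EuclideanSpace ℝ (Fin d)) : θ (-x) = θ x := by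
  rw [← θ.map_abs' (-x), ← θ.map_abs' x]
  simp [vecAbs]

theorem map_combo_le (θ : YoungFunction d) (x y : EuclideanSpace ℝ (Fin d)) {s t : ℝ}
    (hs : 0 ≤ s) (ht : 0 ≤ t) (hst : s + t = 1) :
    θ (s • x + t • y) ≤ ENNReal.ofReal s * θ x + ENNReal.ofReal t * θ y := by
  lift s to ℝ≥0 using hs
  lift t to ℝ≥0 using ht
  have h := θ.convex'.2 (Set.mem_univ x) (Set.mem_univ y) (zero_le (a := s)) (zero_le (a := t))
    (by exact_mod_cast hst)
  simpa [ENNReal.smul_def, NNReal.smul_def] using h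

theorem map_smul_le (θ : YoungFunction d) (x : EuclideanSpace ℝ (Fin d)) {t : ℝ}
    (ht : 0 ≤ t) (ht1 : t ≤ 1) : θ (t • x) ≤ ENNReal.ofReal t * θ x := by
  have h := θ.map_combo_le x 0 ht (sub_nonneg.2 ht1) (by ring)
  simpa [θ.map_zero'] using h

/-- The convex conjugate as a `[0, ∞]`-valued function. As `θ 0 = 0`, the supremum of
`⟪x, y⟫ - θ x` over all `x` is nonnegative, so the terms may be truncated at `0`;
see `coe_conj` for the untruncated formula. -/
noncomputable def conjFun (θ : YoungFunction d) (y : EuclideanSpace ℝ (Fin d)) : ℝ≥0∞ :=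
  ⨆ x : EuclideanSpace ℝ (Fin d), (ENNReal.ofReal (inner ℝ x y) - θ x)

theorem conjFun_convex (θ : YoungFunction d) : ConvexOn ℝ≥0 Set.univ θ.conjFun := by
  refine ⟨convex_univ, fun y _ z _ s t _ _ hst => ?_⟩
  refine iSup_le fun x => ?_
  rcases eq_or_ne (θ x) ∞ with hx | hx
  · simp [hx]
  have h1 : (s : ℝ≥0∞) * (ENNReal.ofReal (inner ℝ x y) - θ x)
      + t * (ENNReal.ofReal (inner ℝ x z) - θ x) ≤ s • θ.conjFun y + t • θ.conjFun z := by
    rw [ENNReal.smul_def, ENNReal.smul_def, smul_eq_mul, smul_eq_mul]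
    gcongr
    · exact le_iSup (fun x => ENNReal.ofReal (inner ℝ x y) - θ x) x
    · exact le_iSup (fun x => ENNReal.ofReal (inner ℝ x z) - θ x) x
  refine le_trans ?_ h1
  rw [tsub_le_iff_right]
  have hst' : (s : ℝ≥0∞) + t = 1 := by exact_mod_cast hst
  calc ENNReal.ofReal (inner ℝ x (s • y + t • z))
      ≤ s * ENNReal.ofReal (inner ℝ x y) + t * ENNReal.ofReal (inner ℝ x z) := by
        rw [inner_add_right, NNReal.smul_def, NNReal.smul_def, inner_smul_right, inner_smul_right]
        refine ENNReal.ofReal_add_le.trans ?_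
        rw [ENNReal.ofReal_mul s.coe_nonneg, ENNReal.ofReal_mul t.coe_nonneg,
          ENNReal.ofReal_coe_nnreal, ENNReal.ofReal_coe_nnreal]
    _ ≤ s * (ENNReal.ofReal (inner ℝ x y) - θ x + θ x)
        + t * (ENNReal.ofReal (inner ℝ x z) - θ x + θ x) := by
        gcongr <;> exact le_tsub_add
    _ = s * (ENNReal.ofReal (inner ℝ x y) - θ x) + t * (ENNReal.ofReal (inner ℝ x z) - θ x)
        + (s + t) * θ x := by ring
    _ = _ := by rw [hst', one_mul]

theorem conjFun_lsc (θ : YoungFunction d) : LowerSemicontinuous θ.conjFun := by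
  refine lowerSemicontinuous_iSup fun x => Continuous.lowerSemicontinuous ?_
  exact (ENNReal.continuous_sub_right _).comp (ENNReal.continuous_ofReal.comp (by fun_prop))

theorem conjFun_abs (θ : YoungFunction d) (y : EuclideanSpace ℝ (Fin d)) :
    θ.conjFun (vecAbs y) = θ.conjFun y := by
  let σ : Fin d → ℝ := fun k => if y k < 0 then -1 else 1
  have hσ : ∀ k, |σ k| = 1 := fun k => by by_cases h : y k < 0 <;> simp [σ, h]
  have hy : ∀ k, σ k * y k = |y k| := fun k => by
    by_cases h : y k < 0
    · simp [σ, h, abs_of_neg h]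
    · simp [σ, h, abs_of_nonneg (not_lt.1 h)]
  have hy' : ∀ k, σ k * |y k| = y k := fun k => by
    by_cases h : y k < 0
    · simp [σ, h, abs_of_neg h]
    · simp [σ, h, abs_of_nonneg (not_lt.1 h)]
  let f : EuclideanSpace ℝ (Fin d) → EuclideanSpace ℝ (Fin d) :=
    fun x => WithLp.toLp 2 (fun k => σ k * x k)
  have hf : ∀ x, θ (f x) = θ x := fun x => by
    rw [← θ.map_abs' (f x), ← θ.map_abs' x]
    simp [vecAbs, f, abs_mul, hσ]
  apply le_antisymm
  · refine iSup_le fun x => ?_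
    refine le_trans (le_of_eq ?_)
      (le_iSup (fun x => ENNReal.ofReal (inner ℝ x y) - θ x) (f x))
    simp only [hf]
    congr 2
    simp only [PiLp.inner_apply, f, vecAbs]
    refine Finset.sum_congr rfl fun k _ => ?_
    simp only [RCLike.inner_apply, conj_trivial]
    rw [← hy k]; ring
  · refine iSup_le fun x => ?_
    refine le_trans (le_of_eq ?_)
      (le_iSup (fun x => ENNReal.ofReal (inner ℝ x (vecAbs y)) - θ x) (f x))
    simp only [hf]
    congr 2
    simp only [PiLp.inner_apply, f, vecAbs]
    refine Finset.sum_congr rfl fun k _ => ?_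
    simp only [RCLike.inner_apply, conj_trivial]
    nth_rewrite 1 [← hy' k]; ring

theorem conjFun_zero (θ : YoungFunction d) : θ.conjFun 0 = 0 := by
  simp [conjFun]

theorem conjFun_dom (θ : YoungFunction d) : {y | θ.conjFun y < ∞} ∈ 𝓝 0 := by
  obtain ⟨a, b, ha, h⟩ := θ.growth'
  refine Filter.mem_of_superset (Metric.ball_mem_nhds 0 ha) fun y hy => ?_
  have hy : ‖y‖ < a := by simpa using hy
  refine lt_of_le_of_lt (iSup_le fun x => ?_) (ENNReal.ofReal_lt_top (r := |b|))
  rw [tsub_le_iff_right]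
  calc ENNReal.ofReal (inner ℝ x y) ≤ ENNReal.ofReal (|b| + (a * ‖x‖ - b)) := by
        apply ENNReal.ofReal_le_ofReal
        have h1 := real_inner_le_norm x y
        have h2 : ‖x‖ * ‖y‖ ≤ ‖x‖ * a := by gcongr
        have h3 := le_abs_self b
        linarith
    _ ≤ ENNReal.ofReal |b| + ENNReal.ofReal (a * ‖x‖ - b) := ENNReal.ofReal_add_le
    _ ≤ _ := by gcongr; exact h x

theorem conjFun_growth (θ : YoungFunction d) :
    ∃ a b : ℝ, 0 < a ∧ ∀ y, ENNReal.ofReal (a * ‖y‖ - b) ≤ θ.conjFun y := by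
  let u : EuclideanSpace ℝ (Fin d) := WithLp.toLp 2 (fun _ => 1)
  obtain ⟨a, ha, hfin⟩ : ∃ a : ℝ, 0 < a ∧ θ (a • u) < ∞ := by
    have hc : Filter.Tendsto (fun a : ℝ => a • u) (𝓝[>] 0) (𝓝 0) := by
      have : Continuous fun a : ℝ => a • u := by fun_prop
      have h0 := this.tendsto 0
      rw [zero_smul] at h0
      exact h0.mono_left nhdsWithin_le_nhds
    obtain ⟨a, h1, h2⟩ := ((hc.eventually θ.dom_mem_nhds').and self_mem_nhdsWithin).exists
    exact ⟨a, h2, h1⟩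
  refine ⟨a, (θ (a • u)).toReal, ha, fun y => ?_⟩
  rw [← θ.conjFun_abs]
  refine le_trans ?_ (le_iSup (fun x => ENNReal.ofReal (inner ℝ x (vecAbs y)) - θ x) (a • u))
  rw [ENNReal.ofReal_sub _ ENNReal.toReal_nonneg, ENNReal.ofReal_toReal hfin.ne]
  gcongr
  have h1 : inner ℝ (a • u) (vecAbs y) = a * ∑ k, |y k| := by
    rw [inner_smul_left]
    simp [PiLp.inner_apply, u, vecAbs]
  rw [h1]
  gcongr
  rw [EuclideanSpace.norm_eq]
  refine Real.sqrt_le_iff.2 ⟨Finset.sum_nonneg fun _ _ => abs_nonneg _, ?_⟩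
  exact Finset.sum_sq_le_sq_sum_of_nonneg fun _ _ => abs_nonneg _

/-- The convex conjugate `θ* (y) = sup_x (x · y - θ x)` of a Young function, which is again a
Young function. -/
noncomputable def conj (θ : YoungFunction d) : YoungFunction d where
  toFun := θ.conjFun
  convex' := θ.conjFun_convex
  lsc' := θ.conjFun_lsc
  map_abs' := θ.conjFun_abs
  map_zero' := θ.conjFun_zero
  dom_mem_nhds' := θ.conjFun_dom
  growth' := θ.conjFun_growth

theorem coe_conj (θ : YoungFunction d) (y : EuclideanSpace ℝ (Fin d)) :
    ((θ.conj y : ℝ≥0∞) : EReal) =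
      ⨆ x : EuclideanSpace ℝ (Fin d), (((inner ℝ x y : ℝ) : EReal) - ((θ x : ℝ≥0∞) : EReal)) := by
  have h0 : (0 : EReal) ≤ ⨆ x : EuclideanSpace ℝ (Fin d),
      (((inner ℝ x y : ℝ) : EReal) - ((θ x : ℝ≥0∞) : EReal)) := by
    refine le_trans (le_of_eq ?_) (le_iSup _ 0)
    simp [θ.map_zero']
  apply le_antisymm
  · rw [← EReal.coe_toENNReal h0]
    refine EReal.coe_ennreal_le_coe_ennreal_iff.2 (iSup_le fun x => ?_)
    rw [tsub_le_iff_right]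
    have h1 := le_iSup (fun x : EuclideanSpace ℝ (Fin d) =>
      (((inner ℝ x y : ℝ) : EReal) - ((θ x : ℝ≥0∞) : EReal))) x
    rw [← EReal.coe_toENNReal h0] at h1
    rcases eq_or_ne (θ x) ∞ with hx | hx
    · simp [hx]
    rw [← EReal.coe_ennreal_le_coe_ennreal_iff, EReal.coe_ennreal_add, EReal.coe_ennreal_ofReal]
    rw [EReal.sub_le_iff_le_add (by simp) (by simp [hx])] at h1
    rw [EReal.coe_strictMono.monotone.map_max]
    refine max_le h1 ?_
    rw [EReal.coe_zero]
    exact add_nonneg (EReal.coe_ennreal_nonneg _) (EReal.coe_ennreal_nonneg _)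
  · refine iSup_le fun x => ?_
    have h1 := le_iSup (fun x => ENNReal.ofReal (inner ℝ x y) - θ x) x
    rw [tsub_le_iff_right, ← EReal.coe_ennreal_le_coe_ennreal_iff, EReal.coe_ennreal_add,
      EReal.coe_ennreal_ofReal] at h1
    rcases eq_or_ne (θ x) ∞ with hx | hx
    · simp [hx]
    rw [EReal.sub_le_iff_le_add (by simp) (by simp [hx])]
    refine le_trans ?_ h1
    exact_mod_cast le_max_left _ _

end YoungFunction

section Orlicz

variable {d : ℕ} {Ω : Type*} [MeasurableSpace Ω]

/-- The Luxemburg norm `inf {c > 0 | E[θ(X / c)] ≤ 1}` of `X ∈ L⁰(ℝᵈ)`, with `inf ∅ = ∞`. -/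
noncomputable def luxemburgNorm (θ : YoungFunction d) {P : Measure Ω}
    (X : Ω →ₘ[P] EuclideanSpace ℝ (Fin d)) : ℝ≥0∞ :=
  ⨅ (c : ℝ) (_ : 0 < c ∧ ∫⁻ ω, θ (c⁻¹ • X ω) ∂P ≤ 1), ENNReal.ofReal c

variable (θ : YoungFunction d) {P : Measure Ω}

theorem YoungFunction.aemeasurable_smul (c : ℝ) (X : Ω →ₘ[P] EuclideanSpace ℝ (Fin d)) :
    AEMeasurable (fun ω => θ (c • X ω)) P :=
  (θ.lsc'.measurable.comp (X.measurable.const_smul c)).aemeasurable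

theorem luxemburgNorm_zero : luxemburgNorm θ (0 : Ω →ₘ[P] EuclideanSpace ℝ (Fin d)) = 0 := by
  refine le_antisymm (ENNReal.le_of_forall_pos_le_add fun ε hε _ => ?_) zero_le
  rw [zero_add]
  refine iInf₂_le_of_le (ε : ℝ) ⟨hε, ?_⟩ (by simp)
  have : ∫⁻ ω, θ ((ε : ℝ)⁻¹ • (0 : Ω →ₘ[P] EuclideanSpace ℝ (Fin d)) ω) ∂P = 0 := by
    rw [lintegral_congr_ae (g := fun _ => 0)]
    · simp
    · filter_upwards [AEEqFun.coeFn_zero (μ := P) (β := EuclideanSpace ℝ (Fin d))] with ω hω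
      simp [hω, θ.map_zero']
  simp [this]

theorem luxemburgNorm_add_le (X Y : Ω →ₘ[P] EuclideanSpace ℝ (Fin d)) :
    luxemburgNorm θ (X + Y) ≤ luxemburgNorm θ X + luxemburgNorm θ Y := by
  have key : ∀ a b : ℝ, (0 < a ∧ ∫⁻ ω, θ (a⁻¹ • X ω) ∂P ≤ 1) →
      (0 < b ∧ ∫⁻ ω, θ (b⁻¹ • Y ω) ∂P ≤ 1) →
      luxemburgNorm θ (X + Y) ≤ ENNReal.ofReal a + ENNReal.ofReal b := by
    rintro a b ⟨ha, hX⟩ ⟨hb, hY⟩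
    rw [← ENNReal.ofReal_add ha.le hb.le]
    refine iInf₂_le _ ⟨by positivity, ?_⟩
    have hab : 0 < a + b := by positivity
    calc ∫⁻ ω, θ ((a + b)⁻¹ • (X + Y) ω) ∂P
        ≤ ∫⁻ ω, (ENNReal.ofReal (a / (a + b)) * θ (a⁻¹ • X ω)
            + ENNReal.ofReal (b / (a + b)) * θ (b⁻¹ • Y ω)) ∂P := by
          refine lintegral_mono_ae ?_
          filter_upwards [AEEqFun.coeFn_add X Y] with ω hω
          have h := θ.map_combo_le (a⁻¹ • X ω) (b⁻¹ • Y ω) (s := a / (a + b)) (t := b / (a + b))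
            (by positivity) (by positivity) (by field_simp)
          refine le_trans (le_of_eq ?_) h
          rw [hω, Pi.add_apply, smul_add, smul_smul, smul_smul]
          congr 3 <;> field_simp
      _ = ENNReal.ofReal (a / (a + b)) * ∫⁻ ω, θ (a⁻¹ • X ω) ∂P
            + ENNReal.ofReal (b / (a + b)) * ∫⁻ ω, θ (b⁻¹ • Y ω) ∂P := by
          rw [lintegral_add_left' ((θ.aemeasurable_smul _ X).const_mul _),
            lintegral_const_mul'' _ (θ.aemeasurable_smul _ X),
            lintegral_const_mul'' _ (θ.aemeasurable_smul _ Y)]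
      _ ≤ ENNReal.ofReal (a / (a + b)) * 1 + ENNReal.ofReal (b / (a + b)) * 1 := by gcongr
      _ = 1 := by
          rw [mul_one, mul_one, ← ENNReal.ofReal_add (by positivity) (by positivity),
            ← add_div, div_self hab.ne', ENNReal.ofReal_one]
  unfold luxemburgNorm at key ⊢
  simp only [ENNReal.iInf_add, ENNReal.add_iInf]
  exact le_iInf₂ fun a ha => le_iInf₂ fun b hb => key _ _ (by assumption) (by assumption)

theorem luxemburgNorm_smul_le (r : ℝ) (X : Ω →ₘ[P] EuclideanSpace ℝ (Fin d)) :
    luxemburgNorm θ (r • X) ≤ ENNReal.ofReal |r| * luxemburgNorm θ X := by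
  rcases eq_or_ne r 0 with rfl | hr
  · rw [zero_smul ℝ X, luxemburgNorm_zero]
    simp
  have hr' : 0 < |r| := abs_pos.2 hr
  have h0 : ENNReal.ofReal |r| ≠ 0 := by simpa using hr
  conv_rhs => unfold luxemburgNorm
  rw [ENNReal.mul_iInf_of_ne h0 ENNReal.ofReal_ne_top]
  refine le_iInf fun c => ?_
  rw [ENNReal.mul_iInf_of_ne h0 ENNReal.ofReal_ne_top]
  refine le_iInf fun hc => ?_
  rw [← ENNReal.ofReal_mul hr'.le]
  refine iInf₂_le _ ⟨mul_pos hr' hc.1, le_trans (le_of_eq ?_) hc.2⟩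
  refine lintegral_congr_ae ?_
  filter_upwards [AEEqFun.coeFn_smul r X] with ω hω
  rw [hω, Pi.smul_apply, smul_smul, mul_inv, mul_right_comm]
  rcases abs_choice r with h | h <;> rw [h]
  · rw [inv_mul_cancel₀ hr, one_mul]
  · rw [inv_neg, neg_mul, inv_mul_cancel₀ hr, neg_mul, one_mul, neg_smul, θ.map_neg]

theorem luxemburgNorm_smul (r : ℝ) (X : Ω →ₘ[P] EuclideanSpace ℝ (Fin d)) :
    luxemburgNorm θ (r • X) = ENNReal.ofReal |r| * luxemburgNorm θ X := by
  rcases eq_or_ne r 0 with rfl | hr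
  · rw [zero_smul ℝ X, luxemburgNorm_zero]
    simp
  refine le_antisymm (luxemburgNorm_smul_le θ r X) ?_
  have h := luxemburgNorm_smul_le θ r⁻¹ (r • X)
  rw [smul_smul, inv_mul_cancel₀ hr, one_smul] at h
  calc ENNReal.ofReal |r| * luxemburgNorm θ X
      ≤ ENNReal.ofReal |r| * (ENNReal.ofReal |r⁻¹| * luxemburgNorm θ (r • X)) := by gcongr
    _ = luxemburgNorm θ (r • X) := by
      rw [← mul_assoc, ← ENNReal.ofReal_mul (abs_nonneg _), ← abs_mul, mul_inv_cancel₀ hr]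
      simp

theorem luxemburgNorm_lt_top_iff (X : Ω →ₘ[P] EuclideanSpace ℝ (Fin d)) :
    luxemburgNorm θ X < ∞ ↔ ∃ c : ℝ, 0 < c ∧ ∫⁻ ω, θ (c⁻¹ • X ω) ∂P < ∞ := by
  constructor
  · intro h
    obtain ⟨c, hc⟩ := iInf_lt_iff.1 h
    obtain ⟨hc, -⟩ := iInf_lt_iff.1 hc
    exact ⟨c, hc.1, hc.2.trans_lt ENNReal.one_lt_top⟩
  · rintro ⟨c, hc, hI⟩
    set I : ℝ := (∫⁻ ω, θ (c⁻¹ • X ω) ∂P).toReal with hIdef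
    have hI0 : 0 ≤ I := ENNReal.toReal_nonneg
    have hI1 : 0 < I + 1 := by positivity
    refine lt_of_le_of_lt (iInf₂_le (c * (I + 1)) ⟨by positivity, ?_⟩) ENNReal.ofReal_lt_top
    calc ∫⁻ ω, θ ((c * (I + 1))⁻¹ • X ω) ∂P
        ≤ ∫⁻ ω, ENNReal.ofReal (I + 1)⁻¹ * θ (c⁻¹ • X ω) ∂P := by
          refine lintegral_mono fun ω => ?_
          have h := θ.map_smul_le (c⁻¹ • X ω) (t := (I + 1)⁻¹) (by positivity)
            (inv_le_one_of_one_le₀ (by linarith))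
          rwa [smul_smul, ← mul_inv, mul_comm] at h
      _ = ENNReal.ofReal (I + 1)⁻¹ * ENNReal.ofReal I := by
          rw [lintegral_const_mul'' _ (θ.aemeasurable_smul _ X), hIdef,
            ENNReal.ofReal_toReal hI.ne]
      _ ≤ 1 := by
          rw [← ENNReal.ofReal_mul (by positivity), ← ENNReal.ofReal_one]
          apply ENNReal.ofReal_le_ofReal
          rw [inv_mul_le_iff₀ hI1]
          linarith

theorem luxemburgNorm_eq_zero [IsProbabilityMeasure P] {X : Ω →ₘ[P] EuclideanSpace ℝ (Fin d)}
    (hX : luxemburgNorm θ X = 0) : X = 0 := by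
  obtain ⟨a, b, ha, hab⟩ := θ.growth'
  have key : ∫⁻ ω, ‖X ω‖ₑ ∂P = 0 := by
    by_contra hne
    set K : ℝ := (1 + |b|) / a with hK
    have hK0 : 0 < K := by positivity
    have hle : ∀ c : ℝ, (0 < c ∧ ∫⁻ ω, θ (c⁻¹ • X ω) ∂P ≤ 1) →
        ∫⁻ ω, ‖X ω‖ₑ ∂P ≤ ENNReal.ofReal K * ENNReal.ofReal c := by
      rintro c ⟨hc, hI⟩
      have hpt : ∀ ω, ‖X ω‖ₑ ≤ ENNReal.ofReal (c / a) * (θ (c⁻¹ • X ω) + ENNReal.ofReal |b|) := by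
        intro ω
        have h1 : ENNReal.ofReal (a * ‖c⁻¹ • X ω‖) ≤ θ (c⁻¹ • X ω) + ENNReal.ofReal |b| := by
          calc ENNReal.ofReal (a * ‖c⁻¹ • X ω‖)
              ≤ ENNReal.ofReal ((a * ‖c⁻¹ • X ω‖ - b) + |b|) := by
                apply ENNReal.ofReal_le_ofReal
                have := le_abs_self b
                linarith
            _ ≤ _ := ENNReal.ofReal_add_le
            _ ≤ _ := by gcongr; exact hab _
        calc ‖X ω‖ₑ = ENNReal.ofReal (c / a) * ENNReal.ofReal (a * ‖c⁻¹ • X ω‖) := by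
              rw [← ENNReal.ofReal_mul (by positivity), ← ofReal_norm, norm_smul,
                norm_inv, Real.norm_of_nonneg hc.le]
              congr 1
              field_simp
          _ ≤ _ := by gcongr
      calc ∫⁻ ω, ‖X ω‖ₑ ∂P
          ≤ ∫⁻ ω, ENNReal.ofReal (c / a) * (θ (c⁻¹ • X ω) + ENNReal.ofReal |b|) ∂P :=
            lintegral_mono hpt
        _ = ENNReal.ofReal (c / a) * (∫⁻ ω, θ (c⁻¹ • X ω) ∂P + ENNReal.ofReal |b|) := by
            rw [lintegral_const_mul'' _ ((θ.aemeasurable_smul _ X).add_const _),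
              lintegral_add_right' _ aemeasurable_const]
            simp
        _ ≤ ENNReal.ofReal (c / a) * (1 + ENNReal.ofReal |b|) := by gcongr
        _ = ENNReal.ofReal K * ENNReal.ofReal c := by
            rw [← ENNReal.ofReal_one, ← ENNReal.ofReal_add zero_le_one (abs_nonneg _),
              ← ENNReal.ofReal_mul (by positivity), ← ENNReal.ofReal_mul (by positivity), hK]
            congr 1
            field_simp
    have h2 : ∫⁻ ω, ‖X ω‖ₑ ∂P ≤ ENNReal.ofReal K * luxemburgNorm θ X := by
      unfold luxemburgNorm
      rw [ENNReal.mul_iInf_of_ne (by simpa using hK0) ENNReal.ofReal_ne_top]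
      refine le_iInf fun c => ?_
      rw [ENNReal.mul_iInf_of_ne (by simpa using hK0) ENNReal.ofReal_ne_top]
      exact le_iInf fun hc => hle c hc
    rw [hX, mul_zero] at h2
    exact hne (le_antisymm h2 zero_le)
  rw [lintegral_eq_zero_iff X.measurable.enorm] at key
  apply AEEqFun.ext
  filter_upwards [key, AEEqFun.coeFn_zero (μ := P) (β := EuclideanSpace ℝ (Fin d))] with ω h1 h2
  rw [h2]
  simpa using h1

variable (P)

/-- The Orlicz space `L^θ = {X ∈ L⁰(ℝᵈ) | ‖X‖_θ < ∞}`. -/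
noncomputable def orliczSpace : Submodule ℝ (Ω →ₘ[P] EuclideanSpace ℝ (Fin d)) where
  carrier := {X | luxemburgNorm θ X < ∞}
  zero_mem' := by simp [luxemburgNorm_zero]
  add_mem' := fun {X Y} hX hY =>
    (luxemburgNorm_add_le θ X Y).trans_lt (ENNReal.add_lt_top.2 ⟨hX, hY⟩)
  smul_mem' := fun r X hX =>
    (luxemburgNorm_smul_le θ r X).trans_lt (ENNReal.mul_lt_top ENNReal.ofReal_lt_top hX)

/-- The Orlicz heart `M^θ = {X ∈ L⁰(ℝᵈ) | E[θ(X / c)] < ∞ for all c > 0}`. -/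
noncomputable def orliczHeart : Submodule ℝ (Ω →ₘ[P] EuclideanSpace ℝ (Fin d)) where
  carrier := {X | ∀ c : ℝ, 0 < c → ∫⁻ ω, θ (c⁻¹ • X ω) ∂P < ∞}
  zero_mem' := by
    intro c _
    rw [lintegral_congr_ae (g := fun _ => 0)]
    · simp
    · filter_upwards [AEEqFun.coeFn_zero (μ := P) (β := EuclideanSpace ℝ (Fin d))] with ω hω
      simp [hω, θ.map_zero']
  add_mem' := by
    intro X Y hX hY c hc
    have hX := hX (c / 2) (by positivity)
    have hY := hY (c / 2) (by positivity)
    refine lt_of_le_of_lt (lintegral_mono_ae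
      (g := fun ω => θ ((c / 2)⁻¹ • X ω) + θ ((c / 2)⁻¹ • Y ω)) ?_) ?_
    · filter_upwards [AEEqFun.coeFn_add X Y] with ω hω
      have h := θ.map_combo_le ((c / 2)⁻¹ • X ω) ((c / 2)⁻¹ • Y ω) (s := 1 / 2) (t := 1 / 2)
        (by positivity) (by positivity) (by norm_num)
      have h12 : ENNReal.ofReal (1 / 2) ≤ 1 := by
        rw [← ENNReal.ofReal_one]
        exact ENNReal.ofReal_le_ofReal (by norm_num)
      calc θ (c⁻¹ • (X + Y) ω)
          = θ ((1 / 2 : ℝ) • (c / 2)⁻¹ • X ω + (1 / 2 : ℝ) • (c / 2)⁻¹ • Y ω) := by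
            rw [hω, Pi.add_apply, smul_add, smul_smul, smul_smul]
            congr 3 <;> field_simp
        _ ≤ _ := h
        _ ≤ 1 * θ ((c / 2)⁻¹ • X ω) + 1 * θ ((c / 2)⁻¹ • Y ω) := by gcongr
        _ = _ := by rw [one_mul, one_mul]
    · rw [lintegral_add_left' (θ.aemeasurable_smul _ X)]
      exact ENNReal.add_lt_top.2 ⟨hX, hY⟩
  smul_mem' := by
    intro r X hX c hc
    have hX := hX (c / (|r| + 1)) (by positivity)
    refine lt_of_le_of_lt (lintegral_mono_ae ?_) hX
    filter_upwards [AEEqFun.coeFn_smul r X] with ω hω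
    have hr : 0 < |r| + 1 := by positivity
    have h := θ.map_smul_le ((c / (|r| + 1))⁻¹ • X ω) (t := |r| / (|r| + 1))
      (by positivity) (by rw [div_le_one hr]; linarith)
    have h1 : ENNReal.ofReal (|r| / (|r| + 1)) ≤ 1 := by
      rw [← ENNReal.ofReal_one]
      exact ENNReal.ofReal_le_ofReal (by rw [div_le_one hr]; linarith)
    have h2 : (|r| / (|r| + 1)) • (c / (|r| + 1))⁻¹ • X ω = |r| • c⁻¹ • X ω := by
      rw [smul_smul, smul_smul]
      congr 1
      field_simp
    have h3 : θ (c⁻¹ • (r • X) ω) = θ (|r| • c⁻¹ • X ω) := by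
      rw [hω, Pi.smul_apply, smul_comm]
      rcases abs_choice r with h | h <;> rw [h]
      rw [neg_smul, θ.map_neg]
    rw [h3, ← h2]
    calc _ ≤ _ := h
      _ ≤ 1 * _ := by gcongr
      _ = _ := one_mul _

theorem orliczHeart_le_orliczSpace : orliczHeart θ P ≤ orliczSpace θ P := fun X hX =>
  (luxemburgNorm_lt_top_iff θ X).2 ⟨1, one_pos, hX 1 one_pos⟩

/-- The Luxemburg norm on the Orlicz space. -/
noncomputable instance : Norm (orliczSpace θ P) := ⟨fun X => (luxemburgNorm θ X.1).toReal⟩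

/-- The Luxemburg norm on the Orlicz heart. -/
noncomputable instance : Norm (orliczHeart θ P) := ⟨fun X => (luxemburgNorm θ X.1).toReal⟩

variable [IsProbabilityMeasure P]

theorem orliczSpace_core : NormedSpace.Core ℝ (orliczSpace θ P) where
  norm_nonneg _ := ENNReal.toReal_nonneg
  norm_smul r X := by
    change (luxemburgNorm θ (r • X.1)).toReal = ‖r‖ * (luxemburgNorm θ X.1).toReal
    rw [luxemburgNorm_smul, ENNReal.toReal_mul, ENNReal.toReal_ofReal (abs_nonneg _),
      Real.norm_eq_abs]
  norm_triangle X Y := by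
    change (luxemburgNorm θ (X.1 + Y.1)).toReal
      ≤ (luxemburgNorm θ X.1).toReal + (luxemburgNorm θ Y.1).toReal
    have hX : luxemburgNorm θ X.1 < ∞ := X.2
    have hY : luxemburgNorm θ Y.1 < ∞ := Y.2
    rw [← ENNReal.toReal_add hX.ne hY.ne]
    exact ENNReal.toReal_mono (ENNReal.add_lt_top.2 ⟨hX, hY⟩).ne (luxemburgNorm_add_le θ _ _)
  norm_eq_zero_iff X := by
    have hX : luxemburgNorm θ X.1 < ∞ := X.2
    change (luxemburgNorm θ X.1).toReal = 0 ↔ X = 0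
    rw [ENNReal.toReal_eq_zero_iff, or_iff_left hX.ne]
    constructor
    · intro h
      exact Subtype.ext (luxemburgNorm_eq_zero θ h)
    · rintro rfl
      exact luxemburgNorm_zero θ

theorem orliczHeart_core : NormedSpace.Core ℝ (orliczHeart θ P) where
  norm_nonneg _ := ENNReal.toReal_nonneg
  norm_smul r X := (orliczSpace_core θ P).norm_smul r
    (Submodule.inclusion (orliczHeart_le_orliczSpace θ P) X)
  norm_triangle X Y := (orliczSpace_core θ P).norm_triangle
    (Submodule.inclusion (orliczHeart_le_orliczSpace θ P) X)
    (Submodule.inclusion (orliczHeart_le_orliczSpace θ P) Y)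
  norm_eq_zero_iff X := by
    have h := (orliczSpace_core θ P).norm_eq_zero_iff
      (Submodule.inclusion (orliczHeart_le_orliczSpace θ P) X)
    refine Iff.trans h ?_
    rw [Subtype.ext_iff, Subtype.ext_iff]
    rfl

noncomputable instance : NormedAddCommGroup (orliczSpace θ P) :=
  NormedAddCommGroup.ofCore (orliczSpace_core θ P)

noncomputable instance : NormedSpace ℝ (orliczSpace θ P) :=
  NormedSpace.ofCore (orliczSpace_core θ P)

noncomputable instance : NormedAddCommGroup (orliczHeart θ P) :=
  NormedAddCommGroup.ofCore (orliczHeart_core θ P)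

noncomputable instance : NormedSpace ℝ (orliczHeart θ P) :=
  NormedSpace.ofCore (orliczHeart_core θ P)

end Orlicz

/-!
# Duality between the Orlicz heart `M^θ` and the Orlicz space `L^{θ*}`

The Fenchel–Young inequality `|x · y| ≤ θ x + θ* y` gives Hölder's inequality
`|E[X · Y]| ≤ 2 ‖X‖_θ ‖Y‖_{θ*}` (`abs_integral_inner_le`), so the pairing is a bounded map from
`L^{θ*}` to the dual of `M^θ`. It remains to see that it is onto and bounded below.

Since `θ` is finite and convex on `ℝᵈ`, it is continuous and bounded on balls. Hence bounded random
vectors lie in `M^θ`, dominated convergence holds there, and simple vectors are dense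
(`dense_range_simpleHeart`).

*Lower bound.* Let `Y` satisfy `E[S · Y] ≤ K ‖S‖_θ` for all simple `S`. By continuity of `θ`, the
supremum `θ* (Y / K) = sup_x (x · Y / K - θ x)` may be taken over a countable dense set, and is
the limit of its values along simple selections `S n` that maximize over the first `n` points.
Because `‖S‖_θ ≤ 1 + E[θ(S)]` (`luxemburgNorm_le_one_add_lintegral`), each
`E[S n · Y / K - θ(S n)]` is at most `1`, and Fatou's lemma yields `E[θ*(Y / K)] ≤ 1`
(`lintegral_conj_le_one`). Thus `‖Y‖_{θ*}` is at most the norm of the functional that `Y`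
represents; this settles both injectivity and continuity of the inverse.

*Surjectivity.* For a bounded functional `ℓ` and a basis vector `eₖ`, the map `A ↦ ℓ(1_A eₖ)` is a
signed measure absolutely continuous with respect to `P` (`hasSum_simpleHeart_restrict`). The
Radon–Nikodym derivatives are the coordinates of a vector `Y` that represents `ℓ` on simple
vectors. The lower bound applied to this `Y` shows `Y ∈ L^{θ*}`, and density extends the
representation to `M^θ`.
-/

open Filter

/-! ### Young functions -/

namespace YoungFunction

variable {d : ℕ} (θ : YoungFunction d)

/-- The Fenchel–Young inequality, with the absolute value of the pairing. -/
theorem enorm_inner_le (x y : EuclideanSpace ℝ (Fin d)) :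
    ‖(inner ℝ x y : ℝ)‖ₑ ≤ θ x + θ.conj y := by
  have key : ∀ z, ENNReal.ofReal (inner ℝ z y) ≤ θ z + θ.conj y := fun z => by
    rw [add_comm, ← tsub_le_iff_right]
    exact le_iSup (fun x => ENNReal.ofReal (inner ℝ x y) - θ x) z
  rw [Real.enorm_eq_ofReal_abs]
  rcases abs_choice (inner ℝ x y : ℝ) with h | h <;> rw [h]
  · exact key x
  · rw [← inner_neg_left, ← θ.map_neg x]
    exact key (-x)

variable {θ}

theorem IsFinite.convexOn_toReal (hθ : θ.IsFinite) :
    ConvexOn ℝ Set.univ fun x => (θ x).toReal := by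
  refine ⟨convex_univ, fun x _ y _ s t hs ht hst => ?_⟩
  have h1 : ENNReal.ofReal s * θ x ≠ ∞ := (ENNReal.mul_lt_top ENNReal.ofReal_lt_top (hθ x)).ne
  have h2 : ENNReal.ofReal t * θ y ≠ ∞ := (ENNReal.mul_lt_top ENNReal.ofReal_lt_top (hθ y)).ne
  have h := ENNReal.toReal_mono (ENNReal.add_ne_top.2 ⟨h1, h2⟩) (θ.map_combo_le x y hs ht hst)
  rwa [ENNReal.toReal_add h1 h2, ENNReal.toReal_mul, ENNReal.toReal_mul,
    ENNReal.toReal_ofReal hs, ENNReal.toReal_ofReal ht] at h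

theorem IsFinite.continuous_toReal (hθ : θ.IsFinite) : Continuous fun x => (θ x).toReal :=
  continuousOn_univ.1 (hθ.convexOn_toReal.continuousOn isOpen_univ)

theorem IsFinite.continuous (hθ : θ.IsFinite) : Continuous θ := by
  have h : (θ : EuclideanSpace ℝ (Fin d) → ℝ≥0∞) = fun x => ENNReal.ofReal (θ x).toReal :=
    funext fun x => (ENNReal.ofReal_toReal (hθ x).ne).symm
  rw [h]
  exact ENNReal.continuous_ofReal.comp hθ.continuous_toReal

theorem IsFinite.exists_bound (hθ : θ.IsFinite) (R : ℝ) :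
    ∃ M : ℝ≥0, ∀ x, ‖x‖ ≤ R → θ x ≤ M := by
  have hK := isCompact_closedBall (0 : EuclideanSpace ℝ (Fin d)) R
  obtain ⟨M, hM⟩ := hK.exists_bound_of_continuousOn hθ.continuous_toReal.continuousOn
  refine ⟨M.toNNReal, fun x hx => ?_⟩
  rw [← ENNReal.ofReal_toReal (hθ x).ne]
  exact ENNReal.ofReal_le_ofReal ((le_abs_self _).trans (hM x (by simpa using hx)))

end YoungFunction

/-! ### The Luxemburg norm and the modular -/

section Luxemburg

variable {d : ℕ} {Ω : Type*} [MeasurableSpace Ω] {P : Measure Ω} {θ : YoungFunction d}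

theorem luxemburgNorm_le_ofReal {X : Ω →ₘ[P] EuclideanSpace ℝ (Fin d)} {c : ℝ} (hc : 0 < c)
    (h : ∫⁻ ω, θ (c⁻¹ • X ω) ∂P ≤ 1) : luxemburgNorm θ X ≤ ENNReal.ofReal c :=
  iInf₂_le c ⟨hc, h⟩

theorem lintegral_le_one_of_luxemburgNorm_lt {X : Ω →ₘ[P] EuclideanSpace ℝ (Fin d)} {c : ℝ}
    (h : luxemburgNorm θ X < ENNReal.ofReal c) : ∫⁻ ω, θ (c⁻¹ • X ω) ∂P ≤ 1 := by
  obtain ⟨e, he⟩ := iInf_lt_iff.1 h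
  obtain ⟨⟨he0, he1⟩, hec⟩ := iInf_lt_iff.1 he
  have hec : e < c := (ENNReal.ofReal_lt_ofReal_iff_of_nonneg he0.le).1 hec
  have hc : 0 < c := he0.trans hec
  refine (lintegral_mono fun ω => ?_).trans he1
  have h1 := θ.map_smul_le (e⁻¹ • X ω) (t := e / c) (by positivity) ((div_le_one hc).2 hec.le)
  have h2 : (e / c) • e⁻¹ • X ω = c⁻¹ • X ω := by
    rw [smul_smul]; congr 1; field_simp
  rw [h2] at h1
  refine h1.trans (mul_le_of_le_one_left zero_le ?_)
  exact ENNReal.ofReal_le_one.2 ((div_le_one hc).2 hec.le)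

/-- The Luxemburg norm is controlled by the modular `E[θ(X)]`. -/
theorem luxemburgNorm_le_one_add_lintegral (X : Ω →ₘ[P] EuclideanSpace ℝ (Fin d)) :
    luxemburgNorm θ X ≤ 1 + ∫⁻ ω, θ (X ω) ∂P := by
  rcases eq_or_ne (∫⁻ ω, θ (X ω) ∂P) ∞ with hI | hI
  · simp [hI]
  set I : ℝ := (∫⁻ ω, θ (X ω) ∂P).toReal with hIdef
  have hI0 : 0 ≤ I := ENNReal.toReal_nonneg
  have h1 : ENNReal.ofReal (1 + I) = 1 + ∫⁻ ω, θ (X ω) ∂P := by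
    rw [ENNReal.ofReal_add zero_le_one hI0, ENNReal.ofReal_one, hIdef, ENNReal.ofReal_toReal hI]
  rw [← h1]
  have hm : AEMeasurable (fun ω => θ (X ω)) P := by simpa using θ.aemeasurable_smul 1 X
  refine luxemburgNorm_le_ofReal (by positivity) ?_
  calc ∫⁻ ω, θ ((1 + I)⁻¹ • X ω) ∂P
      ≤ ∫⁻ ω, ENNReal.ofReal (1 + I)⁻¹ * θ (X ω) ∂P :=
        lintegral_mono fun ω => θ.map_smul_le (X ω) (by positivity)
          (inv_le_one_of_one_le₀ (by linarith))
    _ = ENNReal.ofReal (1 + I)⁻¹ * ENNReal.ofReal I := by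
        rw [lintegral_const_mul'' _ hm, hIdef, ENNReal.ofReal_toReal hI]
    _ ≤ 1 := by
        rw [← ENNReal.ofReal_mul (by positivity), ENNReal.ofReal_le_one,
          inv_mul_le_iff₀ (by positivity)]
        linarith

/-! ### Hölder's inequality -/

theorem lintegral_enorm_inner_le {X Y : Ω →ₘ[P] EuclideanSpace ℝ (Fin d)} {c e : ℝ}
    (hX : luxemburgNorm θ X < ENNReal.ofReal c) (hY : luxemburgNorm θ.conj Y < ENNReal.ofReal e) :
    ∫⁻ ω, ‖(inner ℝ (X ω) (Y ω) : ℝ)‖ₑ ∂P ≤ ENNReal.ofReal (2 * c * e) := by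
  have hc : 0 < c := ENNReal.ofReal_pos.1 (zero_le.trans_lt hX)
  have he : 0 < e := ENNReal.ofReal_pos.1 (zero_le.trans_lt hY)
  have hpt : ∀ ω, ‖(inner ℝ (X ω) (Y ω) : ℝ)‖ₑ
      ≤ ENNReal.ofReal (c * e) * (θ (c⁻¹ • X ω) + θ.conj (e⁻¹ • Y ω)) := fun ω => by
    have h1 : (inner ℝ (X ω) (Y ω) : ℝ) = (c * e) * inner ℝ (c⁻¹ • X ω) (e⁻¹ • Y ω) := by
      rw [real_inner_smul_left, real_inner_smul_right]
      field_simp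
    rw [h1, enorm_mul, Real.enorm_of_nonneg (by positivity : 0 ≤ c * e)]
    gcongr
    exact θ.enorm_inner_le _ _
  calc ∫⁻ ω, ‖(inner ℝ (X ω) (Y ω) : ℝ)‖ₑ ∂P
      ≤ ∫⁻ ω, ENNReal.ofReal (c * e) * (θ (c⁻¹ • X ω) + θ.conj (e⁻¹ • Y ω)) ∂P :=
        lintegral_mono hpt
    _ = ENNReal.ofReal (c * e)
          * (∫⁻ ω, θ (c⁻¹ • X ω) ∂P + ∫⁻ ω, θ.conj (e⁻¹ • Y ω) ∂P) := by
        rw [lintegral_const_mul' _ _ ENNReal.ofReal_ne_top,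
          lintegral_add_left' (θ.aemeasurable_smul _ X)]
    _ ≤ ENNReal.ofReal (c * e) * (1 + 1) := by
        gcongr
        · exact lintegral_le_one_of_luxemburgNorm_lt hX
        · exact lintegral_le_one_of_luxemburgNorm_lt hY
    _ = ENNReal.ofReal (2 * c * e) := by
        rw [one_add_one_eq_two, ← ENNReal.ofReal_ofNat 2, ← ENNReal.ofReal_mul (by positivity)]
        congr 1; ring

theorem aestronglyMeasurable_inner (X Y : Ω →ₘ[P] EuclideanSpace ℝ (Fin d)) :
    AEStronglyMeasurable (fun ω => (inner ℝ (X ω) (Y ω) : ℝ)) P :=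
  X.aestronglyMeasurable.inner Y.aestronglyMeasurable

theorem integrable_inner {X Y : Ω →ₘ[P] EuclideanSpace ℝ (Fin d)}
    (hX : luxemburgNorm θ X < ∞) (hY : luxemburgNorm θ.conj Y < ∞) :
    Integrable (fun ω => (inner ℝ (X ω) (Y ω) : ℝ)) P := by
  have aux : ∀ a : ℝ≥0∞, a < ∞ → a < ENNReal.ofReal (a.toReal + 1) := fun a ha => by
    conv_lhs => rw [← ENNReal.ofReal_toReal ha.ne]
    exact (ENNReal.ofReal_lt_ofReal_iff (by positivity)).2 (by linarith)
  exact ⟨aestronglyMeasurable_inner X Y,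
    (lintegral_enorm_inner_le (aux _ hX) (aux _ hY)).trans_lt ENNReal.ofReal_lt_top⟩

theorem abs_integral_inner_le {X Y : Ω →ₘ[P] EuclideanSpace ℝ (Fin d)}
    (hX : luxemburgNorm θ X < ∞) (hY : luxemburgNorm θ.conj Y < ∞) :
    |∫ ω, inner ℝ (X ω) (Y ω) ∂P|
      ≤ 2 * (luxemburgNorm θ X).toReal * (luxemburgNorm θ.conj Y).toReal := by
  set a := (luxemburgNorm θ X).toReal with ha
  set b := (luxemburgNorm θ.conj Y).toReal with hb
  have hcont : Continuous fun t : ℝ => 2 * (a + t) * (b + t) := by fun_prop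
  have hlim : Tendsto (fun t : ℝ => 2 * (a + t) * (b + t)) (𝓝[>] 0) (𝓝 (2 * a * b)) := by
    have := hcont.tendsto 0
    simp only [add_zero] at this
    exact this.mono_left nhdsWithin_le_nhds
  refine ge_of_tendsto hlim ?_
  filter_upwards [self_mem_nhdsWithin] with t (ht : 0 < t)
  have ha0 : 0 ≤ a := ENNReal.toReal_nonneg
  have hb0 : 0 ≤ b := ENNReal.toReal_nonneg
  have h := lintegral_enorm_inner_le (X := X) (Y := Y) (c := a + t) (e := b + t)
    (by rw [← ENNReal.ofReal_toReal hX.ne]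
        exact (ENNReal.ofReal_lt_ofReal_iff (by positivity)).2 (by linarith))
    (by rw [← ENNReal.ofReal_toReal hY.ne]
        exact (ENNReal.ofReal_lt_ofReal_iff (by positivity)).2 (by linarith))
  have h2 := (enorm_integral_le_lintegral_enorm
    (fun ω => (inner ℝ (X ω) (Y ω) : ℝ))).trans h
  rw [Real.enorm_eq_ofReal_abs] at h2
  exact (ENNReal.ofReal_le_ofReal_iff (by positivity)).1 h2

end Luxemburg

/-! ### Convergence and simple functions in the Orlicz heart -/

section Heart

variable {d : ℕ} {Ω : Type*} [MeasurableSpace Ω] {P : Measure Ω} {θ : YoungFunction d}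

theorem norm_orliczHeart_def (X : orliczHeart θ P) : ‖X‖ = (luxemburgNorm θ X.1).toReal := rfl

theorem norm_orliczSpace_def (X : orliczSpace θ P) : ‖X‖ = (luxemburgNorm θ X.1).toReal := rfl

variable [IsProbabilityMeasure P]

/-- Norm convergence in the Orlicz heart follows from convergence of all scaled modulars. -/
theorem tendsto_orliczHeart_of_modular {ι : Type*} {l : Filter ι} {u : ι → orliczHeart θ P}
    {U : orliczHeart θ P}
    (h : ∀ c : ℝ, 0 < c → Tendsto (fun i => ∫⁻ ω, θ (c⁻¹ • (u i - U).1 ω) ∂P) l (𝓝 0)) :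
    Tendsto u l (𝓝 U) := by
  rw [tendsto_iff_norm_sub_tendsto_zero]
  refine tendsto_order.2 ⟨fun a ha => Eventually.of_forall fun i => ha.trans_le (norm_nonneg _),
    fun ε hε => ?_⟩
  filter_upwards [(h (ε / 2) (by positivity)).eventually (gt_mem_nhds zero_lt_one)] with i hi
  have h1 := luxemburgNorm_le_ofReal (X := (u i - U).1) (by positivity : 0 < ε / 2) hi.le
  rw [norm_orliczHeart_def]
  have h2 := ENNReal.toReal_mono ENNReal.ofReal_ne_top h1
  rw [ENNReal.toReal_ofReal (by positivity)] at h2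
  linarith

/-- Dominated convergence in the Orlicz heart. -/
theorem tendsto_orliczHeart_of_dominated (hθ : θ.IsFinite) {u : ℕ → orliczHeart θ P}
    {U : orliczHeart θ P} (hlim : ∀ᵐ ω ∂P, Tendsto (fun n => (u n).1 ω) atTop (𝓝 (U.1 ω)))
    (hdom : ∀ c : ℝ, 0 < c → ∃ g : Ω → ℝ≥0∞, ∫⁻ ω, g ω ∂P ≠ ∞ ∧
      ∀ n, ∀ᵐ ω ∂P, θ (c⁻¹ • ((u n).1 ω - U.1 ω)) ≤ g ω) :
    Tendsto u atTop (𝓝 U) := by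
  refine tendsto_orliczHeart_of_modular fun c hc => ?_
  have hsub : ∀ n, ∀ᵐ ω ∂P, (u n - U).1 ω = (u n).1 ω - U.1 ω := fun n =>
    AEEqFun.coeFn_sub (u n).1 U.1
  obtain ⟨g, hg, hle⟩ := hdom c hc
  have h := tendsto_lintegral_of_dominated_convergence' (μ := P)
    (F := fun n ω => θ (c⁻¹ • (u n - U).1 ω)) (f := fun _ => 0) g
    (fun n => θ.aemeasurable_smul _ _)
    (fun n => by filter_upwards [hsub n, hle n] with ω h1 h2; rwa [h1]) hg
    (by
      filter_upwards [ae_all_iff.2 hsub, hlim] with ω h1 h2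
      simp only [h1]
      have h3 : Tendsto (fun n => c⁻¹ • ((u n).1 ω - U.1 ω)) atTop (𝓝 0) := by
        simpa using (h2.sub_const (U.1 ω)).const_smul c⁻¹
      have h4 := (hθ.continuous.tendsto 0).comp h3
      rwa [θ.map_zero'] at h4)
  simpa using h

theorem mem_orliczHeart_of_bound (hθ : θ.IsFinite) {X : Ω →ₘ[P] EuclideanSpace ℝ (Fin d)} {R : ℝ}
    (hX : ∀ᵐ ω ∂P, ‖X ω‖ ≤ R) : X ∈ orliczHeart θ P := by
  intro c hc
  obtain ⟨M, hM⟩ := hθ.exists_bound (c⁻¹ * R)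
  refine lt_of_le_of_lt (lintegral_mono_ae (g := fun _ => (M : ℝ≥0∞)) ?_) (by simp)
  filter_upwards [hX] with ω hω
  refine hM _ ?_
  rw [norm_smul, Real.norm_of_nonneg (by positivity)]
  gcongr

variable (P) in
/-- Simple random vectors as elements of the Orlicz heart of a finite Young function. -/
noncomputable def simpleHeart (hθ : θ.IsFinite) :
    SimpleFunc Ω (EuclideanSpace ℝ (Fin d)) →ₗ[ℝ] orliczHeart θ P where
  toFun S := ⟨AEEqFun.mk S S.aestronglyMeasurable, by
    obtain ⟨R, hR⟩ := S.exists_forall_norm_le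
    refine mem_orliczHeart_of_bound hθ (R := R) ?_
    filter_upwards [AEEqFun.coeFn_mk S (S.aestronglyMeasurable (μ := P))] with ω hω
    rw [hω]
    exact hR ω⟩
  map_add' _ _ := rfl
  map_smul' _ _ := rfl

theorem coeFn_simpleHeart (hθ : θ.IsFinite) (S : SimpleFunc Ω (EuclideanSpace ℝ (Fin d))) :
    (simpleHeart P hθ S).1 =ᵐ[P] S :=
  AEEqFun.coeFn_mk S S.aestronglyMeasurable

/-- Simple functions are dense in the Orlicz heart: a bounded vector is a dominated limit of
simple ones, and any element of the heart is a dominated limit of its truncations. -/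
theorem dense_range_simpleHeart (hθ : θ.IsFinite) : DenseRange (simpleHeart P hθ) := by
  set C := closure (Set.range (simpleHeart P hθ)) with hC
  have hbdd : ∀ (R : ℝ) (X : orliczHeart θ P), 0 ≤ R → (∀ᵐ ω ∂P, ‖X.1 ω‖ ≤ R) → X ∈ C := by
    intro R X hR hX
    have hs := X.1.stronglyMeasurable
    refine mem_closure_of_tendsto (b := atTop)
      (f := fun n => simpleHeart P hθ (hs.approxBounded R n))
      (tendsto_orliczHeart_of_dominated hθ ?_ ?_) (Eventually.of_forall fun n => ⟨_, rfl⟩)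
    · filter_upwards [hs.tendsto_approxBounded_ae hX,
        ae_all_iff.2 fun n => coeFn_simpleHeart hθ (hs.approxBounded R n)] with ω h1 h2
      simpa only [h2] using h1
    · intro c hc
      obtain ⟨M, hM⟩ := hθ.exists_bound (c⁻¹ * (R + R))
      refine ⟨fun _ => M, by simp, fun n => ?_⟩
      filter_upwards [hX, coeFn_simpleHeart hθ (hs.approxBounded R n)] with ω h1 h2
      refine hM _ ?_
      rw [h2, norm_smul, Real.norm_of_nonneg (by positivity)]
      gcongr
      exact (norm_sub_le _ _).trans (add_le_add (hs.norm_approxBounded_le hR n ω) h1)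
  intro X
  let T : ℕ → Ω → EuclideanSpace ℝ (Fin d) := fun n => {ω | ‖X.1 ω‖ ≤ n}.indicator X.1
  have hT : ∀ n, AEStronglyMeasurable (T n) P := fun n =>
    (X.1.stronglyMeasurable.indicator
      (measurableSet_le X.1.measurable.norm measurable_const)).aestronglyMeasurable
  have hTn : ∀ n, ∀ᵐ ω ∂P, ‖AEEqFun.mk (T n) (hT n) ω‖ ≤ n := fun n => by
    filter_upwards [AEEqFun.coeFn_mk (T n) (hT n)] with ω hω
    rw [hω]
    by_cases h : ‖X.1 ω‖ ≤ n
    · simp [T, h]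
    · simp [T, h]
  let u : ℕ → orliczHeart θ P := fun n =>
    ⟨AEEqFun.mk (T n) (hT n), mem_orliczHeart_of_bound hθ (hTn n)⟩
  have hu : ∀ n, ∀ᵐ ω ∂P, (u n).1 ω = T n ω := fun n => AEEqFun.coeFn_mk (T n) (hT n)
  refine isClosed_closure.mem_of_tendsto (b := atTop) (f := u)
    (tendsto_orliczHeart_of_dominated hθ ?_ ?_)
    (Eventually.of_forall fun n => hbdd n (u n) n.cast_nonneg (hTn n))
  · filter_upwards [ae_all_iff.2 hu] with ω hω
    simp only [hω]
    refine tendsto_const_nhds.congr' ?_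
    filter_upwards [eventually_ge_atTop ⌈‖X.1 ω‖⌉₊] with n hn
    have : ‖X.1 ω‖ ≤ n := Nat.ceil_le.1 hn
    simp [T, this]
  · intro c hc
    refine ⟨fun ω => θ (c⁻¹ • X.1 ω), (X.2 c hc).ne, fun n => ?_⟩
    filter_upwards [hu n] with ω hω
    rw [hω]
    by_cases h : ‖X.1 ω‖ ≤ n
    · simp [T, h, θ.map_zero']
    · simp [T, h, θ.map_neg]

end Heart

/-! ### The conjugate modular of a bounded functional -/

section Modular

variable {d : ℕ} {Ω : Type*} [MeasurableSpace Ω] {P : Measure Ω} [IsProbabilityMeasure P]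
  {θ : YoungFunction d}

/-- Measurable selection of a maximizer of `x · Z - θ x` among the origin and finitely many
points. The origin makes the attained value nonnegative. -/
theorem exists_simpleFunc_maximizer {Z : Ω → EuclideanSpace ℝ (Fin d)} (hZ : Measurable Z)
    (F : Finset (EuclideanSpace ℝ (Fin d))) (hθ : θ.IsFinite) :
    ∃ S : SimpleFunc Ω (EuclideanSpace ℝ (Fin d)),
      (∀ ω, 0 ≤ inner ℝ (S ω) (Z ω) - (θ (S ω)).toReal) ∧
      ∀ x ∈ F, ∀ ω, inner ℝ x (Z ω) - (θ x).toReal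
        ≤ inner ℝ (S ω) (Z ω) - (θ (S ω)).toReal := by
  classical
  induction F using Finset.induction_on with
  | empty => exact ⟨0, by simp [θ.map_zero'], by simp⟩
  | insert a F _ ih =>
    obtain ⟨S, h0, hS⟩ := ih
    set A := {ω | (inner ℝ (S ω) (Z ω) : ℝ) - (θ (S ω)).toReal
      < inner ℝ a (Z ω) - (θ a).toReal} with hA
    have hAm : MeasurableSet A := by
      refine measurableSet_lt ?_ ?_
      · exact (S.measurable.inner hZ).sub (hθ.continuous_toReal.measurable.comp S.measurable)
      · exact (measurable_const.inner hZ).sub measurable_const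
    refine ⟨(SimpleFunc.const Ω a).piecewise A hAm S, fun ω => ?_, fun x hx ω => ?_⟩
    · by_cases hω : ω ∈ A
      · have h1 : (inner ℝ (S ω) (Z ω) : ℝ) - (θ (S ω)).toReal
          < inner ℝ a (Z ω) - (θ a).toReal := hω
        simpa [hω] using (h0 ω).trans h1.le
      · simpa [hω] using h0 ω
    · by_cases hω : ω ∈ A
      · have h1 : (inner ℝ (S ω) (Z ω) : ℝ) - (θ (S ω)).toReal
          < inner ℝ a (Z ω) - (θ a).toReal := hω
        rcases Finset.mem_insert.1 hx with rfl | hx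
        · simp [hω]
        · simpa [hω] using (hS x hx ω).trans h1.le
      · have h1 := not_lt.1 (show ¬(inner ℝ (S ω) (Z ω) : ℝ) - (θ (S ω)).toReal
          < inner ℝ a (Z ω) - (θ a).toReal from hω)
        rcases Finset.mem_insert.1 hx with rfl | hx
        · simpa [hω] using h1
        · simpa [hω] using hS x hx ω

/-- If `X ↦ E[X · Y]` is bounded by `K` on simple vectors, then `E[θ*(Y / K)] ≤ 1`. The supremum
defining `θ*(Y / K)` is approached by simple vectors `S`, along which
`E[S · Y] / K - E[θ(S)] ≤ ‖S‖ - E[θ(S)] ≤ 1`; Fatou's lemma passes to the limit. -/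
theorem lintegral_conj_le_one (hθ : θ.IsFinite) {Y : Ω → EuclideanSpace ℝ (Fin d)}
    (hY : Measurable Y) {K : ℝ} (hK : 0 < K)
    (hint : ∀ S : SimpleFunc Ω (EuclideanSpace ℝ (Fin d)),
      Integrable (fun ω => (inner ℝ (S ω) (Y ω) : ℝ)) P)
    (hle : ∀ S : SimpleFunc Ω (EuclideanSpace ℝ (Fin d)),
      ∫ ω, inner ℝ (S ω) (Y ω) ∂P ≤ K * ‖simpleHeart P hθ S‖) :
    ∫⁻ ω, θ.conj (K⁻¹ • Y ω) ∂P ≤ 1 := by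
  classical
  have hZ : Measurable fun ω => K⁻¹ • Y ω := hY.const_smul K⁻¹
  -- the value of the maximization problem at a selection
  let v : SimpleFunc Ω (EuclideanSpace ℝ (Fin d)) → Ω → ℝ := fun S ω =>
    inner ℝ (S ω) (K⁻¹ • Y ω) - (θ (S ω)).toReal
  have hv : ∀ S, (∀ ω, 0 ≤ v S ω) → ∫⁻ ω, ENNReal.ofReal (v S ω) ∂P ≤ 1 := by
    intro S hS
    have hθS : Integrable (fun ω => (θ (S ω)).toReal) P :=
      SimpleFunc.integrable_of_isFiniteMeasure (S.map fun x => (θ x).toReal)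
    have hlin : ∫⁻ ω, θ ((simpleHeart P hθ S).1 ω) ∂P
        = ENNReal.ofReal (∫ ω, (θ (S ω)).toReal ∂P) := by
      rw [ofReal_integral_eq_lintegral_ofReal hθS
        (Eventually.of_forall fun _ => ENNReal.toReal_nonneg)]
      refine lintegral_congr_ae ?_
      filter_upwards [coeFn_simpleHeart hθ S] with ω hω
      rw [hω, ENNReal.ofReal_toReal (hθ _).ne]
    have hI0 : 0 ≤ ∫ ω, (θ (S ω)).toReal ∂P := integral_nonneg fun _ => ENNReal.toReal_nonneg
    have hnorm : ‖simpleHeart P hθ S‖ ≤ 1 + ∫ ω, (θ (S ω)).toReal ∂P := by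
      have h := luxemburgNorm_le_one_add_lintegral (θ := θ) (simpleHeart P hθ S).1
      rw [hlin, ← ENNReal.ofReal_one, ← ENNReal.ofReal_add zero_le_one hI0] at h
      have h2 := ENNReal.toReal_mono ENNReal.ofReal_ne_top h
      rwa [ENNReal.toReal_ofReal (by positivity)] at h2
    have hin : (fun ω => (inner ℝ (S ω) (K⁻¹ • Y ω) : ℝ))
        = fun ω => K⁻¹ * inner ℝ (S ω) (Y ω) := by
      funext ω; rw [real_inner_smul_right]
    have hi1 : Integrable (fun ω => (inner ℝ (S ω) (K⁻¹ • Y ω) : ℝ)) P := by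
      rw [hin]; exact (hint S).const_mul _
    have hvi : Integrable (v S) P := hi1.sub hθS
    rw [← ofReal_integral_eq_lintegral_ofReal hvi (Eventually.of_forall hS),
      ENNReal.ofReal_le_one, integral_sub hi1 hθS, hin, integral_const_mul]
    have h3 : K⁻¹ * ∫ ω, inner ℝ (S ω) (Y ω) ∂P ≤ ‖simpleHeart P hθ S‖ := by
      rw [inv_mul_le_iff₀ hK]; exact hle S
    linarith
  let x : ℕ → EuclideanSpace ℝ (Fin d) := TopologicalSpace.denseSeq _
  choose S hS0 hS using fun n : ℕ =>
    exists_simpleFunc_maximizer hZ ((Finset.range n).image x) hθ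
  have hpt : ∀ ω, θ.conj (K⁻¹ • Y ω) ≤ liminf (fun n => ENNReal.ofReal (v (S n) ω)) atTop := by
    intro ω
    set L := liminf (fun n => ENNReal.ofReal (v (S n) ω)) atTop
    have hclosed : IsClosed {z : EuclideanSpace ℝ (Fin d) |
        ENNReal.ofReal (inner ℝ z (K⁻¹ • Y ω) - (θ z).toReal) ≤ L} := by
      refine isClosed_le (ENNReal.continuous_ofReal.comp ?_) continuous_const
      exact (by fun_prop : Continuous fun z : EuclideanSpace ℝ (Fin d) =>
        (inner ℝ z (K⁻¹ • Y ω) : ℝ)).sub hθ.continuous_toReal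
    have hx : ∀ i, ENNReal.ofReal (inner ℝ (x i) (K⁻¹ • Y ω) - (θ (x i)).toReal) ≤ L := fun i => by
      refine le_liminf_of_le (by isBoundedDefault) ?_
      filter_upwards [eventually_gt_atTop i] with n hn
      exact ENNReal.ofReal_le_ofReal
        (hS n (x i) (Finset.mem_image_of_mem x (Finset.mem_range.2 hn)) ω)
    have hall : ∀ z, ENNReal.ofReal (inner ℝ z (K⁻¹ • Y ω) - (θ z).toReal) ≤ L := fun z =>
      (TopologicalSpace.denseRange_denseSeq _).induction_on z hclosed hx
    refine iSup_le fun z => ?_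
    have h := hall z
    rwa [ENNReal.ofReal_sub _ ENNReal.toReal_nonneg, ENNReal.ofReal_toReal (hθ z).ne] at h
  have hmeas : ∀ n, Measurable fun ω => ENNReal.ofReal (v (S n) ω) := fun n =>
    (((S n).measurable.inner hZ).sub
      (hθ.continuous_toReal.measurable.comp (S n).measurable)).ennreal_ofReal
  calc ∫⁻ ω, θ.conj (K⁻¹ • Y ω) ∂P
      ≤ ∫⁻ ω, liminf (fun n => ENNReal.ofReal (v (S n) ω)) atTop ∂P := lintegral_mono hpt
    _ ≤ liminf (fun n => ∫⁻ ω, ENNReal.ofReal (v (S n) ω) ∂P) atTop := lintegral_liminf_le hmeas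
    _ ≤ 1 := liminf_le_of_le (by isBoundedDefault) fun b hb => by
        obtain ⟨n, hn⟩ := hb.exists
        exact hn.trans (hv _ (hS0 n))

end Modular

/-! ### Representation of functionals by Radon–Nikodym derivatives -/

section Representation

variable {d : ℕ} {Ω : Type*} [MeasurableSpace Ω] {P : Measure Ω} [IsProbabilityMeasure P]
  {θ : YoungFunction d}

/-- Countable additivity of `A ↦ 1_A v` in the Orlicz heart: the modular of the remainder is the
probability of a tail of the union times a constant. -/
theorem hasSum_simpleHeart_restrict (hθ : θ.IsFinite) (v : EuclideanSpace ℝ (Fin d))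
    {f : ℕ → Set Ω} (hf : ∀ i, MeasurableSet (f i)) (hd : Pairwise (Function.onFun Disjoint f)) :
    HasSum (fun i => simpleHeart P hθ ((SimpleFunc.const Ω v).restrict (f i)))
      (simpleHeart P hθ ((SimpleFunc.const Ω v).restrict (⋃ i, f i))) := by
  classical
  have hU : MeasurableSet (⋃ i, f i) := MeasurableSet.iUnion hf
  refine tendsto_orliczHeart_of_modular fun c hc => ?_
  have hsum : ∑' i, P (f i) ≠ ∞ := by
    rw [← measure_iUnion hd hf]; exact measure_ne_top _ _
  have htail := ENNReal.Tendsto.const_mul (ENNReal.tendsto_tsum_compl_atTop_zero hsum)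
    (Or.inr (hθ (c⁻¹ • v)).ne)
  rw [mul_zero] at htail
  refine tendsto_of_tendsto_of_tendsto_of_le_of_le tendsto_const_nhds htail
    (fun _ => zero_le) fun s => ?_
  -- the remainder, as a simple function
  set D : SimpleFunc Ω (EuclideanSpace ℝ (Fin d)) :=
    ∑ i ∈ s, (SimpleFunc.const Ω v).restrict (f i) - (SimpleFunc.const Ω v).restrict (⋃ i, f i)
    with hD
  have hDeq : ∑ i ∈ s, simpleHeart P hθ ((SimpleFunc.const Ω v).restrict (f i))
      - simpleHeart P hθ ((SimpleFunc.const Ω v).restrict (⋃ i, f i)) = simpleHeart P hθ D := by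
    rw [hD, map_sub, map_sum]
  set B : Set Ω := ⋃ i : {i // i ∉ s}, f i with hB
  have hBm : MeasurableSet B := MeasurableSet.iUnion fun i => hf i
  have hDval : ∀ ω, D ω = (∑ i ∈ s, (f i).indicator (fun _ => v) ω)
      - (⋃ i, f i).indicator (fun _ => v) ω := fun ω => by
    have hs : ∀ t : Finset ℕ, (∑ i ∈ t, (SimpleFunc.const Ω v).restrict (f i)) ω
        = ∑ i ∈ t, (f i).indicator (fun _ => v) ω := fun t => by
      induction t using Finset.induction_on with
      | empty => simp
      | insert a t ha ih =>
        rw [Finset.sum_insert ha, Finset.sum_insert ha, SimpleFunc.coe_add, Pi.add_apply, ih,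
          SimpleFunc.restrict_apply _ (hf a)]
        rfl
    rw [hD, SimpleFunc.coe_sub, Pi.sub_apply, hs, SimpleFunc.restrict_apply _ hU]
    rfl
  have hpt : ∀ ω, θ (c⁻¹ • D ω) ≤ B.indicator (fun _ => θ (c⁻¹ • v)) ω := fun ω => by
    rw [hDval]
    by_cases hω : ω ∈ ⋃ i, f i
    · obtain ⟨j, hj⟩ := Set.mem_iUnion.1 hω
      have hne : ∀ i, i ≠ j → (f i).indicator (fun _ => v) ω = 0 := fun i hi =>
        Set.indicator_of_notMem (fun h => Set.disjoint_left.1 (hd hi) h hj) _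
      by_cases hjs : j ∈ s
      · rw [Finset.sum_eq_single_of_mem j hjs fun i _ hi => hne i hi]
        simp [hj, hω, θ.map_zero']
      · have hjB : ω ∈ B := Set.mem_iUnion.2 ⟨⟨j, hjs⟩, hj⟩
        rw [Finset.sum_eq_zero fun i hi => hne i fun h => hjs (h ▸ hi)]
        simp [hω, hjB, θ.map_neg]
    · have h0 : ∀ i, ω ∉ f i := fun i hi => hω (Set.mem_iUnion.2 ⟨i, hi⟩)
      simp [h0, θ.map_zero']
  rw [hDeq]
  calc ∫⁻ ω, θ (c⁻¹ • (simpleHeart P hθ D).1 ω) ∂P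
      ≤ ∫⁻ ω, B.indicator (fun _ => θ (c⁻¹ • v)) ω ∂P := by
        refine lintegral_mono_ae ?_
        filter_upwards [coeFn_simpleHeart hθ D] with ω hω
        rw [hω]
        exact hpt ω
    _ = θ (c⁻¹ • v) * P B := lintegral_indicator_const hBm _
    _ ≤ θ (c⁻¹ • v) * ∑' i : {i // i ∉ s}, P (f i) := by
        gcongr
        exact measure_iUnion_le _

/-- The signed measure `A ↦ ℓ(1_A v)` attached to a bounded functional `ℓ` on the Orlicz heart
and a vector `v`. -/
noncomputable def functionalMeasure (hθ : θ.IsFinite) (ℓ : StrongDual ℝ (orliczHeart θ P))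
    (v : EuclideanSpace ℝ (Fin d)) : SignedMeasure Ω where
  measureOf' A := ℓ (simpleHeart P hθ ((SimpleFunc.const Ω v).restrict A))
  empty' := by simp
  not_measurable' A hA := by
    rw [SimpleFunc.restrict_of_not_measurable hA, map_zero, map_zero]
  m_iUnion' _ hf hd := (hasSum_simpleHeart_restrict hθ v hf hd).mapL ℓ

theorem functionalMeasure_absolutelyContinuous (hθ : θ.IsFinite)
    (ℓ : StrongDual ℝ (orliczHeart θ P)) (v : EuclideanSpace ℝ (Fin d)) :
    functionalMeasure hθ ℓ v ≪ᵥ P.toENNRealVectorMeasure := by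
  refine VectorMeasure.AbsolutelyContinuous.mk fun A hA h0 => ?_
  rw [Measure.toENNRealVectorMeasure_apply_measurable hA] at h0
  change ℓ (simpleHeart P hθ ((SimpleFunc.const Ω v).restrict A)) = 0
  have h : simpleHeart P hθ ((SimpleFunc.const Ω v).restrict A) = 0 := by
    refine Subtype.ext (AEEqFun.ext ?_)
    have hA' : ∀ᵐ ω ∂P, ω ∉ A := measure_eq_zero_iff_ae_notMem.1 h0
    filter_upwards [coeFn_simpleHeart hθ ((SimpleFunc.const Ω v).restrict A), hA',
      AEEqFun.coeFn_zero (μ := P) (β := EuclideanSpace ℝ (Fin d))] with ω h1 h2 h3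
    rw [h1, SimpleFunc.restrict_apply _ hA, Set.indicator_of_notMem h2]
    exact h3.symm
  rw [h, map_zero]

/-- The density of a bounded functional: its `k`-th coordinate is the Radon–Nikodym derivative of
`A ↦ ℓ(1_A eₖ)`. -/
noncomputable def functionalDensity (hθ : θ.IsFinite) (ℓ : StrongDual ℝ (orliczHeart θ P))
    (ω : Ω) : EuclideanSpace ℝ (Fin d) :=
  WithLp.toLp 2 fun k =>
    (functionalMeasure hθ ℓ (EuclideanSpace.single k 1)).rnDeriv P ω

theorem measurable_functionalDensity (hθ : θ.IsFinite) (ℓ : StrongDual ℝ (orliczHeart θ P)) :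
    Measurable (functionalDensity hθ ℓ) :=
  (WithLp.measurable_toLp 2 _).comp
    (measurable_pi_lambda _ fun _ => SignedMeasure.measurable_rnDeriv _ _)

/-- The density represents the functional on simple vectors. -/
theorem integral_inner_functionalDensity (hθ : θ.IsFinite) (ℓ : StrongDual ℝ (orliczHeart θ P))
    (S : SimpleFunc Ω (EuclideanSpace ℝ (Fin d))) :
    Integrable (fun ω => (inner ℝ (S ω) (functionalDensity hθ ℓ ω) : ℝ)) P ∧
      ∫ ω, inner ℝ (S ω) (functionalDensity hθ ℓ ω) ∂P = ℓ (simpleHeart P hθ S) := by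
  classical
  induction S using SimpleFunc.induction with
  | const v hA =>
    rename_i A
    let e : Fin d → EuclideanSpace ℝ (Fin d) := fun k => EuclideanSpace.single k 1
    let r : Fin d → Ω → ℝ := fun k => (functionalMeasure hθ ℓ (e k)).rnDeriv P
    have hr : ∀ k, Integrable (r k) P := fun k => SignedMeasure.integrable_rnDeriv _ _
    have hrA : ∀ k, ∫ ω in A, r k ω ∂P
        = ℓ (simpleHeart P hθ ((SimpleFunc.const Ω (e k)).restrict A)) := fun k => by
      rw [← withDensityᵥ_apply (hr k) hA, SignedMeasure.withDensityᵥ_rnDeriv_eq _ _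
        (functionalMeasure_absolutelyContinuous hθ ℓ (e k))]
      rfl
    have hin : (fun ω => (inner ℝ (SimpleFunc.piecewise A hA (SimpleFunc.const Ω v)
        (SimpleFunc.const Ω 0) ω) (functionalDensity hθ ℓ ω) : ℝ))
        = A.indicator fun ω => ∑ k, v k * r k ω := by
      funext ω
      by_cases hω : ω ∈ A
      · simp [hω, functionalDensity, PiLp.inner_apply, r, e, mul_comm]
      · simp [hω]
    have hint : Integrable (fun ω => ∑ k, v k * r k ω) P :=
      integrable_finsetSum _ fun k _ => (hr k).const_mul _
    have hS : SimpleFunc.piecewise A hA (SimpleFunc.const Ω v) (SimpleFunc.const Ω 0)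
        = ∑ k, v k • (SimpleFunc.const Ω (e k)).restrict A := by
      have hsum : ∀ (t : Finset (Fin d)) (ω : Ω),
          (∑ k ∈ t, v k • (SimpleFunc.const Ω (e k)).restrict A) ω
            = ∑ k ∈ t, v k • A.indicator (fun _ => e k) ω := fun t ω => by
        induction t using Finset.induction_on with
        | empty => simp
        | insert a t ha ih =>
          rw [Finset.sum_insert ha, Finset.sum_insert ha, SimpleFunc.coe_add, Pi.add_apply, ih,
            SimpleFunc.smul_apply, SimpleFunc.restrict_apply _ hA]
          rfl
      ext1 ω
      rw [hsum]
      by_cases hω : ω ∈ A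
      · ext j
        simp [hω, e, Pi.single_apply]
      · simp [hω]
    rw [hin]
    refine ⟨hint.indicator hA, ?_⟩
    rw [integral_indicator hA, integral_finsetSum _ fun k _ =>
      ((hr k).const_mul _).integrableOn, hS, map_sum, map_sum]
    refine Finset.sum_congr rfl fun k _ => ?_
    rw [integral_const_mul, hrA, map_smul, map_smul, smul_eq_mul]
  | add _ hf hg =>
    simp only [SimpleFunc.coe_add, Pi.add_apply, inner_add_left]
    refine ⟨hf.1.add hg.1, ?_⟩
    rw [integral_add hf.1 hg.1, hf.2, hg.2, map_add, map_add]

end Representation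

/-! ### Duality -/

section Duality

variable {d : ℕ} {Ω : Type*} [MeasurableSpace Ω] {P : Measure Ω} {θ : YoungFunction d}

theorem integrable_inner_heart (Y : orliczSpace θ.conj P) (X : orliczHeart θ P) :
    Integrable (fun ω => (inner ℝ (X.1 ω) (Y.1 ω) : ℝ)) P :=
  integrable_inner (orliczHeart_le_orliczSpace θ P X.2) Y.2

variable [IsProbabilityMeasure P]

variable (P θ) in
/-- The pairing `Y ↦ (X ↦ E[X · Y])` from `L^{θ*}` to the dual of `M^θ`. -/
noncomputable def orliczPairing : orliczSpace θ.conj P →L[ℝ] StrongDual ℝ (orliczHeart θ P) :=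
  LinearMap.mkContinuous₂
    (LinearMap.mk₂ ℝ (fun (Y : orliczSpace θ.conj P) (X : orliczHeart θ P) =>
        ∫ ω, inner ℝ (X.1 ω) (Y.1 ω) ∂P)
      (fun Y Z X => by
        rw [← integral_add (integrable_inner_heart Y X) (integrable_inner_heart Z X)]
        refine integral_congr_ae ?_
        filter_upwards [AEEqFun.coeFn_add Y.1 Z.1] with ω hω
        rw [Submodule.coe_add, hω, Pi.add_apply, inner_add_right])
      (fun c Y X => by
        rw [smul_eq_mul, ← integral_const_mul]
        refine integral_congr_ae ?_
        filter_upwards [AEEqFun.coeFn_smul c Y.1] with ω hω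
        rw [Submodule.coe_smul, hω, Pi.smul_apply, real_inner_smul_right])
      (fun Y X Z => by
        rw [← integral_add (integrable_inner_heart Y X) (integrable_inner_heart Y Z)]
        refine integral_congr_ae ?_
        filter_upwards [AEEqFun.coeFn_add X.1 Z.1] with ω hω
        rw [Submodule.coe_add, hω, Pi.add_apply, inner_add_left])
      (fun c Y X => by
        rw [smul_eq_mul, ← integral_const_mul]
        refine integral_congr_ae ?_
        filter_upwards [AEEqFun.coeFn_smul c X.1] with ω hω
        rw [Submodule.coe_smul, hω, Pi.smul_apply, real_inner_smul_left]))
    2 (fun Y X => by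
      rw [LinearMap.mk₂_apply, Real.norm_eq_abs, mul_right_comm]
      exact abs_integral_inner_le (orliczHeart_le_orliczSpace θ P X.2) Y.2)

theorem orliczPairing_apply (Y : orliczSpace θ.conj P) (X : orliczHeart θ P) :
    orliczPairing P θ Y X = ∫ ω, inner ℝ (X.1 ω) (Y.1 ω) ∂P := rfl

/-- A random vector that represents a bounded functional on simple vectors has Luxemburg norm at
most the norm of the functional. -/
theorem luxemburgNorm_conj_le (hθ : θ.IsFinite) (ℓ : StrongDual ℝ (orliczHeart θ P))
    (Y : Ω →ₘ[P] EuclideanSpace ℝ (Fin d))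
    (hY : ∀ S : SimpleFunc Ω (EuclideanSpace ℝ (Fin d)),
      Integrable (fun ω => (inner ℝ (S ω) (Y ω) : ℝ)) P ∧
        ∫ ω, inner ℝ (S ω) (Y ω) ∂P = ℓ (simpleHeart P hθ S)) :
    luxemburgNorm θ.conj Y ≤ ENNReal.ofReal ‖ℓ‖ := by
  -- the scale must be positive, and `ℓ` may vanish, so `‖ℓ‖ + ε` is used
  refine ENNReal.le_of_forall_pos_le_add fun ε hε _ => ?_
  have hε' : (0 : ℝ) < ε := hε
  rw [← ENNReal.ofReal_coe_nnreal, ← ENNReal.ofReal_add (norm_nonneg _) ε.coe_nonneg]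
  have hK : 0 < ‖ℓ‖ + ε := by positivity
  refine luxemburgNorm_le_ofReal hK
    (lintegral_conj_le_one hθ Y.measurable hK (fun S => (hY S).1) fun S => ?_)
  rw [(hY S).2]
  refine ((le_abs_self _).trans (ℓ.le_opNorm _)).trans ?_
  gcongr
  linarith

theorem norm_le_norm_orliczPairing (hθ : θ.IsFinite) (Y : orliczSpace θ.conj P) :
    ‖Y‖ ≤ ‖orliczPairing P θ Y‖ := by
  rw [norm_orliczSpace_def]
  refine ENNReal.toReal_le_of_le_ofReal (norm_nonneg _)
    (luxemburgNorm_conj_le hθ (orliczPairing P θ Y) Y.1 fun S => ?_)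
  have hS : (fun ω => (inner ℝ ((simpleHeart P hθ S).1 ω) (Y.1 ω) : ℝ))
      =ᵐ[P] fun ω => inner ℝ (S ω) (Y.1 ω) := by
    filter_upwards [coeFn_simpleHeart hθ S] with ω hω
    rw [hω]
  exact ⟨(integrable_inner_heart Y (simpleHeart P hθ S)).congr hS, (integral_congr_ae hS).symm⟩

theorem orliczPairing_surjective (hθ : θ.IsFinite) :
    Function.Surjective (orliczPairing P θ) := by
  intro ℓ
  have hm := (measurable_functionalDensity hθ ℓ).aestronglyMeasurable (μ := P)
  set Y : Ω →ₘ[P] EuclideanSpace ℝ (Fin d) := AEEqFun.mk (functionalDensity hθ ℓ) hm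
  have hY : ∀ S : SimpleFunc Ω (EuclideanSpace ℝ (Fin d)),
      Integrable (fun ω => (inner ℝ (S ω) (Y ω) : ℝ)) P ∧
        ∫ ω, inner ℝ (S ω) (Y ω) ∂P = ℓ (simpleHeart P hθ S) := fun S => by
    have h : (fun ω => (inner ℝ (S ω) (functionalDensity hθ ℓ ω) : ℝ))
        =ᵐ[P] fun ω => inner ℝ (S ω) (Y ω) := by
      filter_upwards [AEEqFun.coeFn_mk (functionalDensity hθ ℓ) hm] with ω hω
      rw [hω]
    have h0 := integral_inner_functionalDensity hθ ℓ S
    exact ⟨h0.1.congr h, (integral_congr_ae h).symm.trans h0.2⟩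
  refine ⟨⟨Y, (luxemburgNorm_conj_le hθ ℓ Y hY).trans_lt ENNReal.ofReal_lt_top⟩, ?_⟩
  refine ContinuousLinearMap.coeFn_injective ((dense_range_simpleHeart hθ).equalizer
    (ContinuousLinearMap.continuous _) ℓ.continuous (funext fun S => ?_))
  rw [Function.comp_apply, Function.comp_apply, orliczPairing_apply, ← (hY S).2]
  refine integral_congr_ae ?_
  filter_upwards [coeFn_simpleHeart hθ S] with ω hω
  rw [hω]

end Duality

theorem mainTheorem9 {d : ℕ} {Ω : Type*} [MeasurableSpace Ω] (P : Measure Ω)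
    [IsProbabilityMeasure P] (θ : YoungFunction d) (hθ : θ.IsFinite) :
    (∀ (Y : orliczSpace θ.conj P) (X : orliczHeart θ P),
      Integrable (fun ω => inner ℝ (X.1 ω) (Y.1 ω)) P) ∧
    ∃ J : orliczSpace θ.conj P ≃L[ℝ] StrongDual ℝ (orliczHeart θ P),
      ∀ (Y : orliczSpace θ.conj P) (X : orliczHeart θ P),
        J Y X = ∫ ω, inner ℝ (X.1 ω) (Y.1 ω) ∂P := by
  refine ⟨integrable_inner_heart, ?_⟩
  have hinj : Function.Injective (orliczPairing P θ) := by
    refine (injective_iff_map_eq_zero _).2 fun Y hY => norm_le_zero_iff.1 ?_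
    simpa [hY] using norm_le_norm_orliczPairing hθ Y
  let e := LinearEquiv.ofBijective (orliczPairing P θ).toLinearMap
    ⟨hinj, orliczPairing_surjective hθ⟩
  have he : ∀ Y, e Y = orliczPairing P θ Y := fun _ => rfl
  refine ⟨e.toContinuousLinearEquivOfBounds ‖orliczPairing P θ‖ 1
    (fun Y => (orliczPairing P θ).le_opNorm Y) (fun ℓ => ?_), fun Y X => rfl⟩
  have h := norm_le_norm_orliczPairing hθ (e.symm ℓ)
  rwa [← he, e.apply_symm_apply, ← one_mul ‖ℓ‖] at h
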